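/- Let $T>0$, let $b,\sigma:[0,T]\times\mathbb R\to\mathbb R$, $g:[0,T]\times\mathbb R^3\to\mathbb R$ and $H:\mathbb R\to\mathbb R$ be functions, and consider the semilinear equation $$\partial_t u+b(t,x)\,\partial_x u+\tfrac12\sigma^2(t,x)\,\partial_{xx}^2u+g\bigl(t,x,u,\sigma(t,x)\,\partial_xu\bigr)=0,\qquad (t,x)\in[0,T)\times\mathbb R, \qquad (1)$$ with terminal condition $u(T,x)=H(x)$. Let $v=\theta(t,x,u)\,\partial_t+\gamma(t,x,u)\,\partial_x+\phi(t,x,u)\,\partial_u$ be a vector field with coefficients smooth on $[0,T]\times\mathbb R\times\mathbb R$, and let $\Psi_\varepsilon=\exp(\varepsilon v)$ be its local flow on $(0,T)\times\mathbb R\times\mathbb R$. We say that $v$ is a Lie point symmetry of (1) if the second prolongation of the local one-parameter group $\Psi_\varepsilon$ preserves the hypersurface defined by (1) in the space of 2-jets: whenever a smooth function $f$ defined near a point $(t_0,x_0)$, $0<t_0<T$, satisfies (1) at $(t_0,x_0)$, then for all sufficiently small $|\varepsilon|$ the function whose graph is the image under $\Psi_\varepsilon$ of the graph of $f$ near $(t_0,x_0)$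 satisfies (1) at the image base point $(\tilde t_0,\tilde x_0)$, where $(\tilde t_0,\tilde x_0,\tilde u_0)=\Psi_\varepsilon(t_0,x_0,f(t_0,x_0))$. It is a symmetry of (1) with the terminal condition if moreover $\Psi_\varepsilon$ preserves the relation $u=H(x)$: for each point $(t,x,H(x))$ with $0<t<T$ and all sufficiently small $|\varepsilon|$, the image $(\tilde t,\tilde x,\tilde u)$ satisfies $\tilde u=H(\tilde x)$. Suppose that $\sigma(t,x)\neq0$ for all $(t,x)\in[0,T)\times\mathbb R$. Then every Lie point symmetry $v$ of (1), and in particular every symmetry of (1) with the terminal condition, is projectable: there is a function $\tau$ on $[0,T]$ such that $\theta(t,x,u)=\tau(t)$ for all $(t,x,u)\in[0,T]\times\mathbb R\times\mathbb R$. -/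

import Mathlib

open Set Filter Topology
open scoped ContDiff

namespace SemilinearPDE

/-- The left-hand side of
`u_t + b(t,x) u_x + (1/2) σ(t,x)² u_xx + g(t, x, u, u_x σ(t,x)) = 0`,
evaluated at the point `(t, x)` for the function `u`. -/
noncomputable def pdeLHS (b σ : ℝ → ℝ → ℝ) (g : ℝ → ℝ → ℝ → ℝ → ℝ)
    (u : ℝ → ℝ → ℝ) (t x : ℝ) : ℝ :=
  deriv (fun s => u s x) t
    + (b t x * deriv (fun y => u t y) x
        + 1 / 2 * σ t x ^ 2 * iteratedDeriv 2 (fun y => u t y) x)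
    + g t x (u t x) (deriv (fun y => u t y) x * σ t x)

/-- A vector field `θ(t,x,u) ∂_t + γ(t,x,u) ∂_x + φ(t,x,u) ∂_u`. -/
structure PointField where
  θ : ℝ → ℝ → ℝ → ℝ
  γ : ℝ → ℝ → ℝ → ℝ
  φ : ℝ → ℝ → ℝ → ℝ

/-- The value of the vector field at the point `p = (t, x, u)`. -/
def PointField.toVec (v : PointField) (p : ℝ × ℝ × ℝ) : ℝ × ℝ × ℝ :=
  (v.θ p.1 p.2.1 p.2.2, v.γ p.1 p.2.1 p.2.2, v.φ p.1 p.2.1 p.2.2)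

/-- Smoothness of the coefficients on `[0,T] × ℝ × ℝ`. -/
def PointField.IsSmooth (T : ℝ) (v : PointField) : Prop :=
  ContDiffOn ℝ ∞ v.toVec (Icc 0 T ×ˢ (univ : Set (ℝ × ℝ)))

/-- The vector field is projectable: on `[0,T] × ℝ × ℝ` its time component depends only on `t`. -/
def PointField.IsProjectable (T : ℝ) (v : PointField) : Prop :=
  ∃ τ : ℝ → ℝ, ∀ t ∈ Icc 0 T, ∀ x u : ℝ, v.θ t x u = τ t

/-- The open region `(0,T) × ℝ × ℝ` of the space of the variables `(t, x, u)`. -/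
def region (T : ℝ) : Set (ℝ × ℝ × ℝ) := Ioo 0 T ×ˢ univ

/-- `Ψ`, with domain `W`, is a local flow `(ε, p) ↦ exp(ε v) p` of `v` on `(0,T) × ℝ × ℝ`. -/
structure IsLocalFlow (T : ℝ) (v : PointField) (W : Set (ℝ × ℝ × ℝ × ℝ))
    (Ψ : ℝ → ℝ × ℝ × ℝ → ℝ × ℝ × ℝ) : Prop where
  isOpen : IsOpen W
  subset : ∀ ε p, (ε, p) ∈ W → p ∈ region T
  zero_mem : ∀ p ∈ region T, ((0 : ℝ), p) ∈ W
  ordConnected : ∀ p, {ε : ℝ | (ε, p) ∈ W}.OrdConnected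
  mapsTo : ∀ ε p, (ε, p) ∈ W → Ψ ε p ∈ region T
  contDiffOn : ContDiffOn ℝ ∞ (fun q : ℝ × ℝ × ℝ × ℝ => Ψ q.1 q.2) W
  map_zero : ∀ p ∈ region T, Ψ 0 p = p
  hasDerivAt : ∀ ε p, (ε, p) ∈ W → HasDerivAt (fun s => Ψ s p) (v.toVec (Ψ ε p)) ε

/-- Near the point of the graph of `f` over `(t₀, x₀)`, the map `F` of the `(t, x, u)`-space
carries the graph of `f` into the graph of `f'`; so `f'` is the function into which the point
transformation `F` transforms `f`. -/
def TransformsGraph (F : ℝ × ℝ × ℝ → ℝ × ℝ × ℝ) (f f' : ℝ → ℝ → ℝ) (t₀ x₀ : ℝ) : Prop :=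
  ∀ᶠ q : ℝ × ℝ in 𝓝 (t₀, x₀),
    f' (F (q.1, q.2, f q.1 q.2)).1 (F (q.1, q.2, f q.1 q.2)).2.1 = (F (q.1, q.2, f q.1 q.2)).2.2

/-- The prolongation of the local one-parameter group `Ψ` to the second jet space preserves the
hypersurface defined by the equation. A point of this hypersurface is the 2-jet at `(t₀, x₀)` of a
smooth function `f` that satisfies the equation at `(t₀, x₀)`; the prolonged transformation sends
it to the 2-jet, at the transformed base point, of the transformed function `f'`. As usual for
local groups, the parameter `ε` is restricted to a neighbourhood of `0`, which may depend on the
point. -/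
def PreservesEquation (T : ℝ) (b σ : ℝ → ℝ → ℝ) (g : ℝ → ℝ → ℝ → ℝ → ℝ)
    (Ψ : ℝ → ℝ × ℝ × ℝ → ℝ × ℝ × ℝ) : Prop :=
  ∀ t₀ ∈ Ioo 0 T, ∀ (x₀ : ℝ) (f : ℝ → ℝ → ℝ),
    ContDiffAt ℝ ∞ (fun q : ℝ × ℝ => f q.1 q.2) (t₀, x₀) →
    pdeLHS b σ g f t₀ x₀ = 0 →
    ∀ᶠ ε in 𝓝 (0 : ℝ), ∀ f' : ℝ → ℝ → ℝ,
      ContDiffAt ℝ ∞ (fun q : ℝ × ℝ => f' q.1 q.2)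
        ((Ψ ε (t₀, x₀, f t₀ x₀)).1, (Ψ ε (t₀, x₀, f t₀ x₀)).2.1) →
      TransformsGraph (Ψ ε) f f' t₀ x₀ →
      pdeLHS b σ g f' (Ψ ε (t₀, x₀, f t₀ x₀)).1 (Ψ ε (t₀, x₀, f t₀ x₀)).2.1 = 0

/-- The local one-parameter group `Ψ` preserves the relation `u = H(x)` of the terminal condition,
at every time level. -/
def PreservesTerminal (T : ℝ) (H : ℝ → ℝ) (Ψ : ℝ → ℝ × ℝ × ℝ → ℝ × ℝ × ℝ) : Prop :=
  ∀ t ∈ Ioo 0 T, ∀ x : ℝ, ∀ᶠ ε in 𝓝 (0 : ℝ),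
    (Ψ ε (t, x, H x)).2.2 = H (Ψ ε (t, x, H x)).2.1

/-- `v` generates a local one-parameter group of Lie point symmetries of the equation
`u_t + b u_x + (1/2) σ² u_xx + g(t, x, u, u_x σ) = 0`. -/
def IsSymmetryOfEquation (T : ℝ) (b σ : ℝ → ℝ → ℝ) (g : ℝ → ℝ → ℝ → ℝ → ℝ)
    (v : PointField) : Prop :=
  v.IsSmooth T ∧ ∃ W Ψ, IsLocalFlow T v W Ψ ∧ PreservesEquation T b σ g Ψ

/-- `v` generates a local one-parameter group of Lie point symmetries of the equation together with
its terminal condition `u(T, x) = H(x)`. -/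
def IsSymmetryOfTerminalProblem (T : ℝ) (b σ : ℝ → ℝ → ℝ) (g : ℝ → ℝ → ℝ → ℝ → ℝ)
    (H : ℝ → ℝ) (v : PointField) : Prop :=
  v.IsSmooth T ∧ ∃ W Ψ, IsLocalFlow T v W Ψ ∧ PreservesEquation T b σ g Ψ ∧
    PreservesTerminal T H Ψ

end SemilinearPDE

open Asymptotics

namespace SemilinearPDE

/-! The equation contains no `u_tt`, so adding `(t - t₀) ^ 2` to a function does not affect whether
it holds at `(t₀, x₀)`. Let `f₁` be a polynomial satisfying it there, with `x`-slope `p`, and `f₂ =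
f₁ + (t - t₀) ^ 2`. For small `ε` both images satisfy the equation at one common point. Their
difference has the exact order of `(t - t₀) ^ 2` pulled back by the inverse base map
(`isTheta_sub_of_transformsGraph`), so their 1-jets agree, and since `σ ≠ 0` so do their second
`x`-derivatives (`isLittleO_sub_of_pdeLHS_eq_zero`). Hence along `∂_x` the pulled-back `t - t₀`
vanishes to first order: the base map preserves the direction `∂_x` (`time_component_eq_zero`).

Thus the flow sends `∂_x + p ∂_u` to a vector without time component. Differentiating at `ε = 0`
gives `θ_x + p θ_u = 0` for every `p`, so `θ` depends on `t` alone for `0 < t < T`; continuity gives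
the endpoints. -/

/-! ### Second-order contact of two solutions -/

/-- A function vanishing to second order at a point is `o((x - x₀) ^ 2)` there. -/
theorem isLittleO_sq_of_iteratedDeriv_two_eq_zero {e : ℝ → ℝ} {x₀ : ℝ} (he : ContDiffAt ℝ 2 e x₀)
    (h0 : e x₀ = 0) (h1 : deriv e x₀ = 0) (h2 : iteratedDeriv 2 e x₀ = 0) :
    e =o[𝓝 x₀] fun x => (x - x₀) ^ 2 := by
  obtain ⟨r, hr, hball⟩ := Metric.eventually_nhds_iff_ball.1
    ((he.eventually (by simp)).mono fun y hy => hy.differentiableAt (by simp))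
  have hd : DifferentiableAt ℝ (deriv e) x₀ := by
    exact (he.derivWithin (m := 1) (by norm_num)).differentiableAt (by simp)
  have h2' : HasDerivAt (deriv e) 0 x₀ := by
    rw [← h2, iteratedDeriv_succ, iteratedDeriv_one]
    exact hd.hasDerivAt
  have ho : deriv e =o[𝓝 x₀] fun x => (x - x₀) ^ 1 := by
    have := hasDerivAt_iff_isLittleO.1 h2'
    simpa [h1] using this
  have hx : x₀ ∈ Metric.ball x₀ r := Metric.mem_ball_self hr
  -- The estimate `o(x - x₀)` for the derivative integrates to `o((x - x₀) ^ 2)` for the function.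
  have key := Convex.isLittleO_pow_succ_real (convex_ball x₀ r) hx
    (fun x hx => (hball x hx).hasDerivAt.hasDerivWithinAt)
    (ho.mono nhdsWithin_le_nhds)
  rw [Metric.isOpen_ball.nhdsWithin_eq hx] at key
  simpa [h0] using key

/-- Two solutions of the equation at a point that agree to second order up to `O(‖y - y₀‖ ^ 2)`
have the same second derivative in `x`, so that they agree to order `o(s ^ 2)` in direction `x`. -/
theorem isLittleO_sub_of_pdeLHS_eq_zero {b σ : ℝ → ℝ → ℝ} {g : ℝ → ℝ → ℝ → ℝ → ℝ}
    {φ ψ : ℝ → ℝ → ℝ} {y₀ : ℝ × ℝ} (hσ : σ y₀.1 y₀.2 ≠ 0)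
    (hφ : ContDiffAt ℝ ∞ (fun q : ℝ × ℝ => φ q.1 q.2) y₀)
    (hψ : ContDiffAt ℝ ∞ (fun q : ℝ × ℝ => ψ q.1 q.2) y₀)
    (hφ0 : pdeLHS b σ g φ y₀.1 y₀.2 = 0) (hψ0 : pdeLHS b σ g ψ y₀.1 y₀.2 = 0)
    (h : (fun y : ℝ × ℝ => ψ y.1 y.2 - φ y.1 y.2) =O[𝓝 y₀] fun y => ‖y - y₀‖ ^ 2) :
    (fun x => ψ y₀.1 x - φ y₀.1 x) =o[𝓝 y₀.2] fun x => (x - y₀.2) ^ 2 := by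
  have hx : ContDiff ℝ ∞ fun x : ℝ => (y₀.1, x) := by fun_prop
  have ht : ContDiff ℝ ∞ fun t : ℝ => (t, y₀.2) := by fun_prop
  have hφx : ContDiffAt ℝ ∞ (φ y₀.1) y₀.2 :=
    ContDiffAt.comp (g := fun q : ℝ × ℝ => φ q.1 q.2) y₀.2 hφ hx.contDiffAt
  have hψx : ContDiffAt ℝ ∞ (ψ y₀.1) y₀.2 :=
    ContDiffAt.comp (g := fun q : ℝ × ℝ => ψ q.1 q.2) y₀.2 hψ hx.contDiffAt
  have hφt : ContDiffAt ℝ ∞ (fun t => φ t y₀.2) y₀.1 :=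
    ContDiffAt.comp (g := fun q : ℝ × ℝ => φ q.1 q.2) y₀.1 hφ ht.contDiffAt
  have hψt : ContDiffAt ℝ ∞ (fun t => ψ t y₀.2) y₀.1 :=
    ContDiffAt.comp (g := fun q : ℝ × ℝ => ψ q.1 q.2) y₀.1 hψ ht.contDiffAt
  -- A quadratic bound forces derivative zero, so the two 1-jets agree.
  have hd := h.hasFDerivAt (𝕜 := ℝ) one_lt_two
  have h0 : ψ y₀.1 y₀.2 - φ y₀.1 y₀.2 = 0 := by
    obtain ⟨c, hc⟩ := h.bound
    simpa using hc.self_of_nhds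
  have hdx : HasDerivAt (fun x => ψ y₀.1 x - φ y₀.1 x) 0 y₀.2 := by
    exact hd.comp_hasDerivAt (f := fun x : ℝ => (y₀.1, x)) y₀.2
      ((hasDerivAt_const _ _).prodMk (hasDerivAt_id _))
  have hdt : HasDerivAt (fun t => ψ t y₀.2 - φ t y₀.2) 0 y₀.1 := by
    exact hd.comp_hasDerivAt (f := fun t : ℝ => (t, y₀.2)) y₀.1
      ((hasDerivAt_id _).prodMk (hasDerivAt_const _ _))
  have ex : deriv (ψ y₀.1) y₀.2 = deriv (φ y₀.1) y₀.2 := by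
    have := hdx.deriv
    rw [deriv_fun_sub (hψx.differentiableAt (by simp)) (hφx.differentiableAt (by simp))] at this
    linarith
  have et : deriv (fun t => ψ t y₀.2) y₀.1 = deriv (fun t => φ t y₀.2) y₀.1 := by
    have := hdt.deriv
    rw [deriv_fun_sub (hψt.differentiableAt (by simp)) (hφt.differentiableAt (by simp))] at this
    linarith
  have h2 : iteratedDeriv 2 (ψ y₀.1) y₀.2 = iteratedDeriv 2 (φ y₀.1) y₀.2 := by
    have e0 : ψ y₀.1 y₀.2 = φ y₀.1 y₀.2 := by linarith
    unfold pdeLHS at hφ0 hψ0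
    simp only [et, ex, e0] at hψ0
    have : 1 / 2 * σ y₀.1 y₀.2 ^ 2 *
        (iteratedDeriv 2 (ψ y₀.1) y₀.2 - iteratedDeriv 2 (φ y₀.1) y₀.2) = 0 := by
      linarith
    have h3 : 1 / 2 * σ y₀.1 y₀.2 ^ 2 ≠ 0 := by positivity
    linarith [(mul_eq_zero.1 this).resolve_left h3]
  refine isLittleO_sq_of_iteratedDeriv_two_eq_zero
    ((hψx.sub hφx).of_le ENat.LEInfty.out) h0 hdx.deriv ?_
  rw [iteratedDeriv_fun_sub (hψx.of_le ENat.LEInfty.out)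
    (hφx.of_le ENat.LEInfty.out), h2, sub_self]

/-! ### Graphs under a point transformation -/

/-- The projection of the `(t, x, u)`-space to the `(t, x)`-plane. -/
def baseProj : ℝ × ℝ × ℝ →L[ℝ] ℝ × ℝ :=
  (ContinuousLinearMap.fst ℝ ℝ (ℝ × ℝ)).prod
    (ContinuousLinearMap.fst ℝ ℝ ℝ ∘L ContinuousLinearMap.snd ℝ ℝ (ℝ × ℝ))

/-- The parametrization of the graph of `f` by the `(t, x)`-plane. -/
def graphMap (f : ℝ → ℝ → ℝ) (q : ℝ × ℝ) : ℝ × ℝ × ℝ := (q.1, q.2, f q.1 q.2)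

/-- The derivative of `graphMap f` where `f` has derivative `l`. -/
def graphLift (l : ℝ × ℝ →L[ℝ] ℝ) : ℝ × ℝ →L[ℝ] ℝ × ℝ × ℝ :=
  (ContinuousLinearMap.fst ℝ ℝ ℝ).prod ((ContinuousLinearMap.snd ℝ ℝ ℝ).prod l)

theorem contDiffAt_graphMap {f : ℝ → ℝ → ℝ} {q₀ : ℝ × ℝ}
    (hf : ContDiffAt ℝ ∞ (fun q : ℝ × ℝ => f q.1 q.2) q₀) : ContDiffAt ℝ ∞ (graphMap f) q₀ :=
  contDiffAt_fst.prodMk (contDiffAt_snd.prodMk hf)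

theorem hasFDerivAt_graphMap {f : ℝ → ℝ → ℝ} {q₀ : ℝ × ℝ} {l : ℝ × ℝ →L[ℝ] ℝ}
    (hf : HasFDerivAt (fun q : ℝ × ℝ => f q.1 q.2) l q₀) :
    HasFDerivAt (graphMap f) (graphLift l) q₀ :=
  hasFDerivAt_fst.prodMk (hasFDerivAt_snd.prodMk hf)

theorem baseProj_comp_graphLift (l : ℝ × ℝ →L[ℝ] ℝ) :
    baseProj ∘L graphLift l = ContinuousLinearMap.id ℝ (ℝ × ℝ) := by
  ext <;> simp [baseProj, graphLift]

/-- A point transformation whose action on the base along the graph of `f` is a local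
diffeomorphism transforms `f` into a smooth function. -/
theorem exists_transformsGraph {F : ℝ × ℝ × ℝ → ℝ × ℝ × ℝ} {f : ℝ → ℝ → ℝ} {q₀ : ℝ × ℝ}
    {A : (ℝ × ℝ) ≃L[ℝ] ℝ × ℝ}
    (hF : ContDiffAt ℝ ∞ F (graphMap f q₀))
    (hf : ContDiffAt ℝ ∞ (fun q : ℝ × ℝ => f q.1 q.2) q₀)
    (hA : HasFDerivAt (fun q => baseProj (F (graphMap f q))) (A : ℝ × ℝ →L[ℝ] ℝ × ℝ) q₀) :
    ∃ f' : ℝ → ℝ → ℝ,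
      ContDiffAt ℝ ∞ (fun q : ℝ × ℝ => f' q.1 q.2) (baseProj (F (graphMap f q₀))) ∧
      TransformsGraph F f f' q₀.1 q₀.2 := by
  have hFf : ContDiffAt ℝ ∞ (fun q => F (graphMap f q)) q₀ :=
    ContDiffAt.comp q₀ hF (contDiffAt_graphMap hf)
  have hBF : ContDiffAt ℝ ∞ (fun q => baseProj (F (graphMap f q))) q₀ :=
    baseProj.contDiff.contDiffAt.comp q₀ hFf
  have hs := hBF.hasStrictFDerivAt' hA (by simp)
  have hB := hBF.to_localInverse hA (by simp)
  set B := hBF.localInverse hA (by simp) with hBdef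
  have hB0 : B (baseProj (F (graphMap f q₀))) = q₀ := hBF.localInverse_apply_image hA (by simp)
  refine ⟨fun t x => (F (graphMap f (B (t, x)))).2.2, ?_, ?_⟩
  · have h := ContDiffAt.comp (g := fun q => F (graphMap f q)) (baseProj (F (graphMap f q₀)))
      (by rw [hB0]; exact hFf) hB
    exact h.snd.snd
  · have := hs.eventually_left_inverse
    filter_upwards [this] with q hq
    have hq' : B (baseProj (F (graphMap f q))) = q := hq
    change (F (graphMap f (B (baseProj (F (graphMap f q)))))).2.2 = _
    rw [hq']
    rfl

/-- If an invertible linear map carries the graph of `l` into the graph of `m`, then it carries the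
vertical direction `∂_u` to a direction transverse to the graph of `m`. -/
theorem vertical_ne_zero {F' : ℝ × ℝ × ℝ →L[ℝ] ℝ × ℝ × ℝ} (hF' : Function.Surjective F')
    {l m : ℝ × ℝ →L[ℝ] ℝ}
    (h : ∀ z, (F' (graphLift l z)).2.2 - m (baseProj (F' (graphLift l z))) = 0) :
    (F' (0, 0, 1)).2.2 - m (baseProj (F' (0, 0, 1))) ≠ 0 := by
  intro h0
  -- Otherwise the form `du - m` would vanish on the whole range of `F'`, which contains `∂_u`,
  -- where it equals 1.
  obtain ⟨z, hz⟩ := hF' (0, 0, 1)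
  have hdec : z = graphLift l (baseProj z) +
      (z.2.2 - l (baseProj z)) • ((0 : ℝ), (0 : ℝ), (1 : ℝ)) := by
    obtain ⟨t, x, u⟩ := z
    simp [graphLift, baseProj]
  have h1 := h (baseProj z)
  have h2 : (F' z).2.2 - m (baseProj (F' z)) = 0 := by
    rw [hdec]
    simp only [map_add, map_smul, Prod.snd_add, Prod.smul_snd, smul_eq_mul]
    linear_combination h1 + (z.2.2 - l (baseProj z)) * h0
  rw [hz] at h2
  have h3 : baseProj ((0 : ℝ), (0 : ℝ), (1 : ℝ)) = 0 := by simp [baseProj]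
  rw [h3, map_zero, sub_zero] at h2
  exact one_ne_zero h2

/-- If `f₂ = f₁ + (t - t₀) ^ 2`, then the functions into which a local diffeomorphism transforms
`f₁` and `f₂` differ by a quantity of the exact order of the transported `(t - t₀) ^ 2`. -/
theorem isTheta_sub_of_transformsGraph {F : ℝ × ℝ × ℝ → ℝ × ℝ × ℝ} {f₁ f₂ φ ψ : ℝ → ℝ → ℝ}
    {q₀ : ℝ × ℝ} {F' : ℝ × ℝ × ℝ →L[ℝ] ℝ × ℝ × ℝ} {l : ℝ × ℝ →L[ℝ] ℝ} {B : ℝ × ℝ → ℝ × ℝ}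
    (hF : ContDiffAt ℝ ∞ F (graphMap f₁ q₀)) (hF' : HasFDerivAt F F' (graphMap f₁ q₀))
    (hsurj : Function.Surjective F')
    (hf₁ : HasFDerivAt (fun q : ℝ × ℝ => f₁ q.1 q.2) l q₀)
    (hf₂ : ∀ t x, f₂ t x = f₁ t x + (t - q₀.1) ^ 2)
    (hψ : ContDiffAt ℝ ∞ (fun q : ℝ × ℝ => ψ q.1 q.2) (baseProj (F (graphMap f₁ q₀))))
    (hTφ : TransformsGraph F f₁ φ q₀.1 q₀.2) (hTψ : TransformsGraph F f₂ ψ q₀.1 q₀.2)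
    (hB : Tendsto B (𝓝 (baseProj (F (graphMap f₁ q₀)))) (𝓝 q₀))
    (hBr : ∀ᶠ y in 𝓝 (baseProj (F (graphMap f₁ q₀))), baseProj (F (graphMap f₁ (B y))) = y) :
    (fun y : ℝ × ℝ => ψ y.1 y.2 - φ y.1 y.2) =Θ[𝓝 (baseProj (F (graphMap f₁ q₀)))]
      fun y => ((B y).1 - q₀.1) ^ 2 := by
  have hp : graphMap f₂ q₀ = graphMap f₁ q₀ := by simp [graphMap, hf₂]
  have hf₂' : HasFDerivAt (fun q : ℝ × ℝ => f₂ q.1 q.2) l q₀ := by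
    simp only [hf₂]
    have h := ((hasFDerivAt_fst (𝕜 := ℝ) (p := q₀)).sub_const q₀.1).pow 2
    refine (hf₁.add h).congr_fderiv ?_
    simp
  have hg₁ := hasFDerivAt_graphMap hf₁
  have hg₂ := hasFDerivAt_graphMap hf₂'
  have hψ' := (hψ.differentiableAt (by simp)).hasFDerivAt
  set m := fderiv ℝ (fun q : ℝ × ℝ => ψ q.1 q.2) (baseProj (F (graphMap f₁ q₀)))
  -- A defining function of the graph of `ψ`, pulled back by `F`: it vanishes on the graph of `f₂`,
  -- and on that of `f₁` it measures `φ - ψ`.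
  set G : ℝ × ℝ × ℝ → ℝ := fun p => (F p).2.2 - ψ (F p).1 (F p).2.1 with hGdef
  have hGs : ContDiffAt ℝ ∞ G (graphMap f₁ q₀) :=
    hF.snd.snd.sub (ContDiffAt.comp (g := fun q : ℝ × ℝ => ψ q.1 q.2)
      (f := fun p => baseProj (F p)) _ hψ (baseProj.contDiff.contDiffAt.comp _ hF))
  set G' : ℝ × ℝ × ℝ →L[ℝ] ℝ :=
    ContinuousLinearMap.snd ℝ ℝ ℝ ∘L ContinuousLinearMap.snd ℝ ℝ (ℝ × ℝ) ∘L F'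
      - m ∘L baseProj ∘L F' with hG'
  have hGd : HasFDerivAt G G' (graphMap f₁ q₀) :=
    hF'.snd.snd.sub (HasFDerivAt.comp (g := fun q : ℝ × ℝ => ψ q.1 q.2)
      (f := fun p => baseProj (F p)) _ hψ' (baseProj.hasFDerivAt.comp _ hF'))
  have hstrict := hGs.hasStrictFDerivAt' hGd (by simp)
  have hG2 : ∀ᶠ q in 𝓝 q₀, G (graphMap f₂ q) = 0 := by
    filter_upwards [hTψ] with q hq
    exact sub_eq_zero.2 hq.symm
  have hzero : G' ∘L graphLift l = 0 := by
    have h1 : HasFDerivAt (fun q => G (graphMap f₂ q)) (G' ∘L graphLift l) q₀ :=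
      HasFDerivAt.comp (g := G) q₀ (by rw [hp]; exact hGd) hg₂
    exact h1.unique ((hasFDerivAt_const (0 : ℝ) q₀).congr_of_eventuallyEq hG2)
  have hk : G' (0, 0, 1) ≠ 0 := by
    refine vertical_ne_zero hsurj (l := l) (m := m) fun z => ?_
    exact DFunLike.congr_fun hzero z
  set k := G' (0, 0, 1)
  have hdiff : ∀ q : ℝ × ℝ, graphMap f₂ q - graphMap f₁ q
      = ((q.1 - q₀.1) ^ 2) • ((0 : ℝ), (0 : ℝ), (1 : ℝ)) := by
    intro q
    simp [graphMap, hf₂]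
  have htend : Tendsto (fun q => (graphMap f₂ q, graphMap f₁ q)) (𝓝 q₀)
      (𝓝 (graphMap f₁ q₀, graphMap f₁ q₀)) := by
    have h2 := hg₂.continuousAt.tendsto
    rw [hp] at h2
    exact h2.prodMk_nhds hg₁.continuousAt
  -- Both points over `q` move, so strict differentiability of `G` is needed; they differ by a
  -- vertical vector of length `(q.1 - q₀.1) ^ 2`.
  have ho : (fun q => -G (graphMap f₁ q) - k * (q.1 - q₀.1) ^ 2) =o[𝓝 q₀]
      fun q : ℝ × ℝ => k * (q.1 - q₀.1) ^ 2 := by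
    have h1 := hstrict.isLittleO.comp_tendsto htend
    have h2 : (fun q => -G (graphMap f₁ q) - k * (q.1 - q₀.1) ^ 2) =o[𝓝 q₀]
        fun q : ℝ × ℝ => ((q.1 - q₀.1) ^ 2) • ((0 : ℝ), (0 : ℝ), (1 : ℝ)) := by
      refine h1.congr' ?_ ?_
      · filter_upwards [hG2] with q hq
        simp only [Function.comp_apply, hq, hdiff, map_smul, smul_eq_mul]
        ring
      · exact Eventually.of_forall hdiff
    refine h2.trans_isBigO (IsBigO.of_bound |k|⁻¹ (Eventually.of_forall fun q => ?_))
    rw [norm_smul, norm_mul, Real.norm_eq_abs k, ← mul_assoc, inv_mul_cancel₀ (abs_ne_zero.2 hk)]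
    simp [Prod.norm_def]
  have hΘ : (fun q => -G (graphMap f₁ q)) =Θ[𝓝 q₀] fun q : ℝ × ℝ => (q.1 - q₀.1) ^ 2 :=
    (IsEquivalent.isTheta (v := fun q : ℝ × ℝ => k * (q.1 - q₀.1) ^ 2) ho).trans
      ((isTheta_refl _ _).const_mul_left hk)
  have hΘB : (fun y => -G (graphMap f₁ (B y))) =Θ[𝓝 (baseProj (F (graphMap f₁ q₀)))]
      fun y => ((B y).1 - q₀.1) ^ 2 :=
    ⟨hΘ.1.comp_tendsto hB, hΘ.2.comp_tendsto hB⟩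
  refine EventuallyEq.trans_isTheta ?_ hΘB
  filter_upwards [hBr, hB.eventually hTφ] with y hy hφy
  have e1 : (F (graphMap f₁ (B y))).1 = y.1 := congrArg Prod.fst hy
  have e2 : (F (graphMap f₁ (B y))).2.1 = y.2 := congrArg Prod.snd hy
  have e3 : φ (F (graphMap f₁ (B y))).1 (F (graphMap f₁ (B y))).2.1
    = (F (graphMap f₁ (B y))).2.2 := hφy
  simp only [hGdef]
  rw [← e3, e1, e2]
  ring

/-- If a point transformation carries two functions `f₁` and `f₁ + (t - t₀) ^ 2` to functions that
both satisfy the equation at the image point, then at that point it maps the tangent direction of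
the graph of `f₁` over `∂_x` to a direction with zero time component. -/
theorem time_component_eq_zero {b σ : ℝ → ℝ → ℝ} {g : ℝ → ℝ → ℝ → ℝ → ℝ}
    {F : ℝ × ℝ × ℝ → ℝ × ℝ × ℝ} {f₁ f₂ : ℝ → ℝ → ℝ}
    {q₀ : ℝ × ℝ} {F' : ℝ × ℝ × ℝ →L[ℝ] ℝ × ℝ × ℝ} {l : ℝ × ℝ →L[ℝ] ℝ}
    {A : (ℝ × ℝ) ≃L[ℝ] ℝ × ℝ}
    (hF : ContDiffAt ℝ ∞ F (graphMap f₁ q₀)) (hF' : HasFDerivAt F F' (graphMap f₁ q₀))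
    (hsurj : Function.Surjective F') (hA : (A : ℝ × ℝ →L[ℝ] ℝ × ℝ) = baseProj ∘L F' ∘L graphLift l)
    (hf₁s : ContDiffAt ℝ ∞ (fun q : ℝ × ℝ => f₁ q.1 q.2) q₀)
    (hf₂s : ContDiffAt ℝ ∞ (fun q : ℝ × ℝ => f₂ q.1 q.2) q₀)
    (hf₁ : HasFDerivAt (fun q : ℝ × ℝ => f₁ q.1 q.2) l q₀)
    (hf₂ : HasFDerivAt (fun q : ℝ × ℝ => f₂ q.1 q.2) l q₀)
    (hf : ∀ t x, f₂ t x = f₁ t x + (t - q₀.1) ^ 2)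
    (hσ : σ (F (graphMap f₁ q₀)).1 (F (graphMap f₁ q₀)).2.1 ≠ 0)
    (hE : ∀ f ∈ ({f₁, f₂} : Set (ℝ → ℝ → ℝ)), ∀ f' : ℝ → ℝ → ℝ,
      ContDiffAt ℝ ∞ (fun q : ℝ × ℝ => f' q.1 q.2) (baseProj (F (graphMap f q₀))) →
      TransformsGraph F f f' q₀.1 q₀.2 →
      pdeLHS b σ g f' (F (graphMap f q₀)).1 (F (graphMap f q₀)).2.1 = 0) :
    (F' (graphLift l (0, 1))).1 = 0 := by
  have hp : graphMap f₂ q₀ = graphMap f₁ q₀ := by simp [graphMap, hf]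
  have hA₁ : HasFDerivAt (fun q => baseProj (F (graphMap f₁ q))) (A : ℝ × ℝ →L[ℝ] ℝ × ℝ) q₀ := by
    rw [hA]
    exact baseProj.hasFDerivAt.comp q₀ (hF'.comp q₀ (hasFDerivAt_graphMap hf₁))
  have hA₂ : HasFDerivAt (fun q => baseProj (F (graphMap f₂ q))) (A : ℝ × ℝ →L[ℝ] ℝ × ℝ) q₀ := by
    rw [hA]
    exact baseProj.hasFDerivAt.comp q₀
      (HasFDerivAt.comp (g := F) q₀ (by rw [hp]; exact hF') (hasFDerivAt_graphMap hf₂))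
  obtain ⟨φ, hφ, hTφ⟩ := exists_transformsGraph hF hf₁s hA₁
  obtain ⟨ψ, hψ, hTψ⟩ := exists_transformsGraph (by rw [hp]; exact hF) hf₂s hA₂
  have hφE := hE f₁ (by simp) φ hφ hTφ
  have hψE := hE f₂ (by simp) ψ hψ hTψ
  rw [hp] at hψ hψE
  have hBF : ContDiffAt ℝ ∞ (fun q => baseProj (F (graphMap f₁ q))) q₀ :=
    baseProj.contDiff.contDiffAt.comp q₀ (ContDiffAt.comp q₀ hF (contDiffAt_graphMap hf₁s))
  have hs := hBF.hasStrictFDerivAt' hA₁ (by simp)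
  have hBd := hs.to_localInverse.hasFDerivAt
  have hBr := hs.eventually_right_inverse
  have hBt := hs.localInverse_tendsto
  have hB0 := hs.localInverse_apply_image
  set B := hs.localInverse
  set y₀ := baseProj (F (graphMap f₁ q₀)) with hy₀
  have hΘ := isTheta_sub_of_transformsGraph hF hF' hsurj hf₁ hf hψ hTφ hTψ hBt hBr
  have hBO : (fun y => ((B y).1 - q₀.1) ^ 2) =O[𝓝 y₀] fun y => ‖y - y₀‖ ^ 2 := by
    have h1 := hBd.fst.isBigO_sub
    simp only [hB0] at h1
    exact h1.norm_right.pow 2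
  have hO := hΘ.1.trans hBO
  have hlit := isLittleO_sub_of_pdeLHS_eq_zero (y₀ := y₀) hσ hφ hψ hφE hψE hO
  have hcx : Tendsto (fun x : ℝ => (y₀.1, x)) (𝓝 y₀.2) (𝓝 y₀) :=
    (Continuous.prodMk_right y₀.1).tendsto y₀.2
  have h2 : (fun x => ((B (y₀.1, x)).1 - q₀.1) ^ 2) =o[𝓝 y₀.2] fun x => (x - y₀.2) ^ 2 :=
    (hΘ.2.comp_tendsto hcx).trans_isLittleO hlit
  have h3 : (fun x => (B (y₀.1, x)).1 - q₀.1) =o[𝓝 y₀.2] fun x => x - y₀.2 :=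
    IsLittleO.of_pow (n := 2) h2 two_ne_zero
  have hd0 : HasDerivAt (fun x => (B (y₀.1, x)).1) 0 y₀.2 := by
    rw [hasDerivAt_iff_isLittleO]
    have e : (B (y₀.1, y₀.2)).1 = q₀.1 := congrArg Prod.fst hB0
    simpa [e] using h3
  -- The same derivative computed from the inverse of `A`; comparison shows that `A.symm` maps `∂_x`
  -- to a multiple of itself, nonzero by injectivity, and hence so does `A`.
  have hd1 : HasDerivAt (fun x => (B (y₀.1, x)).1)
      ((A.symm : ℝ × ℝ →L[ℝ] ℝ × ℝ) (0, 1)).1 y₀.2 :=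
    (hBd.comp_hasDerivAt (f := fun x : ℝ => (y₀.1, x)) y₀.2
      ((hasDerivAt_const _ _).prodMk (hasDerivAt_id _))).fst
  have h0 : (A.symm (0, 1)).1 = 0 := hd1.unique hd0
  have h1 : A (A.symm (0, 1)) = (0, 1) := A.apply_symm_apply _
  have hsm : A.symm (0, 1) = (A.symm (0, 1)).2 • ((0 : ℝ), (1 : ℝ)) := by
    ext <;> simp [h0]
  have hβ : (A.symm (0, 1)).2 ≠ 0 := by
    intro h
    rw [h, zero_smul] at hsm
    rw [hsm, map_zero] at h1
    exact zero_ne_one (congrArg Prod.snd h1)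
  rw [hsm, map_smul] at h1
  have h4 : (A (0, 1)).1 = 0 := by
    have := congrArg Prod.fst h1
    simpa [hβ] using this
  have h5 : A (0, 1) = baseProj (F' (graphLift l (0, 1))) := DFunLike.congr_fun hA (0, 1)
  rw [h5] at h4
  exact h4

/-! ### Quadratic test functions -/

theorem isOpen_region (T : ℝ) : IsOpen (region T) := isOpen_Ioo.prod isOpen_univ

/-- The derivative at `(t₀, x₀)` of a quadratic function with prescribed 1-jet there. -/
theorem hasFDerivAt_quadratic (t₀ x₀ u₀ q p c : ℝ) :
    HasFDerivAt (fun y : ℝ × ℝ => u₀ + q * (y.1 - t₀) + p * (y.2 - x₀) + c * (y.1 - t₀) ^ 2)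
      (q • ContinuousLinearMap.fst ℝ ℝ ℝ + p • ContinuousLinearMap.snd ℝ ℝ ℝ) (t₀, x₀) := by
  have h1 := (hasFDerivAt_fst (𝕜 := ℝ) (p := (t₀, x₀))).sub_const t₀
  have h2 := (hasFDerivAt_snd (𝕜 := ℝ) (p := (t₀, x₀))).sub_const x₀
  refine ((((h1.const_mul q).const_add u₀).add (h2.const_mul p)).add
    ((h1.pow 2).const_mul c)).congr_fderiv ?_
  simp

theorem contDiff_quadratic (t₀ x₀ u₀ q p c : ℝ) :
    ContDiff ℝ ∞ fun y : ℝ × ℝ =>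
      u₀ + q * (y.1 - t₀) + p * (y.2 - x₀) + c * (y.1 - t₀) ^ 2 := by
  fun_prop

/-- The absence of `c` on the right is what lets two test functions with different `u_tt` satisfy
the equation together. -/
theorem pdeLHS_quadratic (b σ : ℝ → ℝ → ℝ) (g : ℝ → ℝ → ℝ → ℝ → ℝ) (t₀ x₀ u₀ q p c : ℝ) :
    pdeLHS b σ g (fun t x => u₀ + q * (t - t₀) + p * (x - x₀) + c * (t - t₀) ^ 2) t₀ x₀
      = q + b t₀ x₀ * p + g t₀ x₀ u₀ (p * σ t₀ x₀) := by
  have hx : deriv (fun x : ℝ => u₀ + q * (t₀ - t₀) + p * (x - x₀) + c * (t₀ - t₀) ^ 2)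
      = fun _ => p := by
    funext x
    simp
  have ht : deriv (fun t : ℝ => u₀ + q * (t - t₀) + p * (x₀ - x₀) + c * (t - t₀) ^ 2) t₀ = q := by
    have h0 := (hasDerivAt_id t₀).sub_const t₀
    have h := (((h0.const_mul q).const_add u₀).add_const (p * (x₀ - x₀))).add
      ((h0.pow 2).const_mul c)
    refine (h.congr_deriv ?_).deriv
    simp
  unfold pdeLHS
  rw [iteratedDeriv_succ, iteratedDeriv_one]
  simp only [hx, ht]
  simp

/-! ### From the flow to its generator -/

section Flow

variable {T : ℝ} {v : PointField} {W : Set (ℝ × ℝ × ℝ × ℝ)} {Ψ : ℝ → ℝ × ℝ × ℝ → ℝ × ℝ × ℝ}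

theorem IsLocalFlow.contDiffAt (h : IsLocalFlow T v W Ψ) {q : ℝ × ℝ × ℝ × ℝ} (hq : q ∈ W) :
    ContDiffAt ℝ ∞ (fun q : ℝ × ℝ × ℝ × ℝ => Ψ q.1 q.2) q :=
  h.contDiffOn.contDiffAt (h.isOpen.mem_nhds hq)

/-- The derivative in the space variables of the time-`ε` map of a flow. -/
noncomputable def spaceDeriv (Ψ : ℝ → ℝ × ℝ × ℝ → ℝ × ℝ × ℝ) (p : ℝ × ℝ × ℝ) (ε : ℝ) :
    ℝ × ℝ × ℝ →L[ℝ] ℝ × ℝ × ℝ :=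
  fderiv ℝ (fun q : ℝ × ℝ × ℝ × ℝ => Ψ q.1 q.2) (ε, p) ∘L
    ContinuousLinearMap.inr ℝ ℝ (ℝ × ℝ × ℝ)

theorem IsLocalFlow.hasFDerivAt_spaceDeriv (h : IsLocalFlow T v W Ψ) {ε : ℝ} {p : ℝ × ℝ × ℝ}
    (hq : (ε, p) ∈ W) : HasFDerivAt (Ψ ε) (spaceDeriv Ψ p ε) p :=
  ((h.contDiffAt hq).differentiableAt (by simp)).hasFDerivAt.comp (f := fun p => (ε, p)) p
    (hasFDerivAt_prodMk_right ε p)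

theorem IsLocalFlow.spaceDeriv_zero (h : IsLocalFlow T v W Ψ) {p : ℝ × ℝ × ℝ}
    (hp : p ∈ region T) : spaceDeriv Ψ p 0 = ContinuousLinearMap.id ℝ (ℝ × ℝ × ℝ) := by
  refine (h.hasFDerivAt_spaceDeriv (h.zero_mem p hp)).unique
    ((hasFDerivAt_id p).congr_of_eventuallyEq ?_)
  filter_upwards [(isOpen_region T).mem_nhds hp] with y hy using h.map_zero y hy

theorem IsLocalFlow.contDiffAt_fderiv (h : IsLocalFlow T v W Ψ) {q : ℝ × ℝ × ℝ × ℝ} (hq : q ∈ W) :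
    ContDiffAt ℝ 1 (fderiv ℝ (fun q : ℝ × ℝ × ℝ × ℝ => Ψ q.1 q.2)) q :=
  ((h.contDiffAt hq).of_le ENat.LEInfty.out).fderiv_right (n := 2) (by norm_num)

theorem IsLocalFlow.continuousAt_spaceDeriv (h : IsLocalFlow T v W Ψ) {p : ℝ × ℝ × ℝ}
    (hp : p ∈ region T) : ContinuousAt (spaceDeriv Ψ p) 0 := by
  have h1 : ContinuousAt
      (fun ε : ℝ => fderiv ℝ (fun q : ℝ × ℝ × ℝ × ℝ => Ψ q.1 q.2) (ε, p)) 0 :=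
    ContinuousAt.comp (f := fun ε : ℝ => (ε, p)) (h.contDiffAt_fderiv (h.zero_mem p hp)).continuousAt
      (Continuous.prodMk_left p).continuousAt
  exact h1.clm_comp continuousAt_const

/-- The derivative at `ε = 0` of the space derivative of the flow is the derivative of the
vector field. -/
theorem IsLocalFlow.hasDerivAt_toVec_of_spaceDeriv (h : IsLocalFlow T v W Ψ) {p w : ℝ × ℝ × ℝ}
    (hp : p ∈ region T) (hw : ∀ᶠ ε in 𝓝 (0 : ℝ), (spaceDeriv Ψ p ε w).1 = 0) :
    HasDerivAt (fun s : ℝ => (v.toVec (p + s • w)).1) 0 0 := by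
  have h0 := h.zero_mem p hp
  set Φ : ℝ × ℝ × ℝ × ℝ → ℝ × ℝ × ℝ := fun q => Ψ q.1 q.2 with hΦ
  have hΦ2 := ((h.contDiffAt_fderiv h0).differentiableAt one_ne_zero).hasFDerivAt
  set S := fderiv ℝ (fderiv ℝ Φ) (0, p) with hS
  -- Symmetry of mixed derivatives exchanges the `ε`-derivative of the space derivative with the
  -- derivative of `v` along `w`.
  have hsymm : S (1, 0) (0, w) = S (0, w) (1, 0) :=
    (h.contDiffAt h0).isSymmSndFDerivAt (by simpa using ENat.LEInfty.out) _ _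
  have hε : HasDerivAt (fun ε : ℝ => (fderiv ℝ Φ (ε, p) (0, w)).1) (S (1, 0) (0, w)).1 0 := by
    have h1 := hΦ2.comp_hasDerivAt (f := fun ε : ℝ => (ε, p)) (0 : ℝ)
      ((hasDerivAt_id _).prodMk (hasDerivAt_const _ _))
    have h2 := h1.clm_apply (hasDerivAt_const (0 : ℝ) ((0 : ℝ), w))
    refine (hasFDerivAt_fst.comp_hasDerivAt (0 : ℝ) h2).congr_deriv ?_
    simp
  have hzero : (S (1, 0) (0, w)).1 = 0 := by
    refine hε.unique ((hasDerivAt_const (0 : ℝ) (0 : ℝ)).congr_of_eventuallyEq ?_)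
    filter_upwards [hw] with ε hε
    simpa [spaceDeriv] using hε
  have hline : HasDerivAt (fun s : ℝ => ((0 : ℝ), p + s • w)) ((0 : ℝ), w) 0 := by
    have h1 := ((hasDerivAt_id (0 : ℝ)).smul_const w).const_add p
    rw [one_smul] at h1
    exact (hasDerivAt_const _ _).prodMk h1
  have hs : HasDerivAt (fun s : ℝ => (fderiv ℝ Φ (0, p + s • w) (1, 0)).1)
      (S (0, w) (1, 0)).1 0 := by
    have h1 := HasFDerivAt.comp_hasDerivAt (l := fderiv ℝ Φ) (f := fun s : ℝ => ((0 : ℝ), p + s • w))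
      (0 : ℝ) (by simpa using hΦ2) hline
    have h2 := h1.clm_apply (hasDerivAt_const (0 : ℝ) ((1 : ℝ), (0 : ℝ × ℝ × ℝ)))
    refine (hasFDerivAt_fst.comp_hasDerivAt (0 : ℝ) h2).congr_deriv ?_
    simp
  rw [← hsymm, hzero] at hs
  refine hs.congr_of_eventuallyEq ?_
  have hreg : ∀ᶠ s : ℝ in 𝓝 0, p + s • w ∈ region T := by
    have hc : ContinuousAt (fun s : ℝ => p + s • w) 0 := by fun_prop
    exact hc.eventually_mem ((isOpen_region T).mem_nhds (by simpa using hp))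
  filter_upwards [hreg] with s hs'
  have hq := h.zero_mem _ hs'
  have h1 := ((h.contDiffAt hq).differentiableAt (by simp)).hasFDerivAt.comp_hasDerivAt
    (f := fun ε : ℝ => (ε, p + s • w)) (0 : ℝ)
    ((hasDerivAt_id _).prodMk (hasDerivAt_const _ _))
  have h2 := h.hasDerivAt 0 _ hq
  rw [h.map_zero _ hs'] at h2
  exact congrArg Prod.fst (h2.unique h1)

variable {b σ : ℝ → ℝ → ℝ} {g : ℝ → ℝ → ℝ → ℝ → ℝ}

/-- Under a flow preserving the equation, the time component of the image of a direction
`∂_x + p ∂_u` vanishes for small `ε`. -/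
theorem IsLocalFlow.eventually_spaceDeriv_fst_eq_zero (h : IsLocalFlow T v W Ψ)
    (hE : PreservesEquation T b σ g Ψ) (hσ : ∀ t ∈ Ioo 0 T, ∀ x : ℝ, σ t x ≠ 0)
    {t₀ : ℝ} (ht₀ : t₀ ∈ Ioo 0 T) (x₀ u₀ p : ℝ) :
    ∀ᶠ ε in 𝓝 (0 : ℝ), (spaceDeriv Ψ (t₀, x₀, u₀) ε (0, 1, p)).1 = 0 := by
  have hp : (t₀, x₀, u₀) ∈ region T := ⟨ht₀, mem_univ _⟩
  -- The value of `u_t` that makes the equation hold at the point, whatever `p` is.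
  set q := -(b t₀ x₀ * p + g t₀ x₀ u₀ (p * σ t₀ x₀)) with hq
  set f : ℝ → ℝ → ℝ → ℝ :=
    fun c t x => u₀ + q * (t - t₀) + p * (x - x₀) + c * (t - t₀) ^ 2 with hf
  have hf0 : ∀ c, graphMap (f c) (t₀, x₀) = (t₀, x₀, u₀) := fun c => by simp [graphMap, hf]
  have hf0' : ∀ c, f c t₀ x₀ = u₀ := fun c => by simp [hf]
  have hfE : ∀ c, ∀ᶠ ε in 𝓝 (0 : ℝ), ∀ f' : ℝ → ℝ → ℝ,
      ContDiffAt ℝ ∞ (fun q : ℝ × ℝ => f' q.1 q.2) (baseProj (Ψ ε (t₀, x₀, u₀))) →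
      TransformsGraph (Ψ ε) (f c) f' t₀ x₀ →
      pdeLHS b σ g f' (Ψ ε (t₀, x₀, u₀)).1 (Ψ ε (t₀, x₀, u₀)).2.1 = 0 := by
    intro c
    have h1 := hE t₀ ht₀ x₀ (f c) (contDiff_quadratic t₀ x₀ u₀ q p c).contDiffAt
      (by rw [pdeLHS_quadratic, hq]; ring)
    rw [hf0'] at h1
    exact h1
  set l : ℝ × ℝ →L[ℝ] ℝ := q • ContinuousLinearMap.fst ℝ ℝ ℝ + p • ContinuousLinearMap.snd ℝ ℝ ℝ
  have hc := h.continuousAt_spaceDeriv hp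
  have hW : ∀ᶠ ε in 𝓝 (0 : ℝ), (ε, t₀, x₀, u₀) ∈ W :=
    (Continuous.prodMk_left (t₀, x₀, u₀)).continuousAt.eventually_mem
      (h.isOpen.mem_nhds (h.zero_mem _ hp))
  -- Both maps are the identity at `ε = 0`, and invertibility is an open condition.
  have hinv : ∀ᶠ ε in 𝓝 (0 : ℝ), spaceDeriv Ψ (t₀, x₀, u₀) ε ∈
      range ((↑) : ((ℝ × ℝ × ℝ) ≃L[ℝ] ℝ × ℝ × ℝ) → (ℝ × ℝ × ℝ →L[ℝ] ℝ × ℝ × ℝ)) := by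
    refine hc.eventually_mem (ContinuousLinearEquiv.isOpen.mem_nhds ?_)
    rw [h.spaceDeriv_zero hp]
    exact ⟨ContinuousLinearEquiv.refl ℝ _, rfl⟩
  have hinvA : ∀ᶠ ε in 𝓝 (0 : ℝ), baseProj ∘L spaceDeriv Ψ (t₀, x₀, u₀) ε ∘L graphLift l ∈
      range ((↑) : ((ℝ × ℝ) ≃L[ℝ] ℝ × ℝ) → (ℝ × ℝ →L[ℝ] ℝ × ℝ)) := by
    have hc' : ContinuousAt
        (fun ε => baseProj ∘L spaceDeriv Ψ (t₀, x₀, u₀) ε ∘L graphLift l) 0 :=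
      continuousAt_const.clm_comp (hc.clm_comp continuousAt_const)
    refine hc'.eventually_mem (ContinuousLinearEquiv.isOpen.mem_nhds ?_)
    rw [h.spaceDeriv_zero hp, ContinuousLinearMap.id_comp, baseProj_comp_graphLift]
    exact ⟨ContinuousLinearEquiv.refl ℝ _, rfl⟩
  filter_upwards [hfE 0, hfE 1, hW, hinv, hinvA] with ε hE0 hE1 hεW ⟨L, hL⟩ ⟨A, hA⟩
  have hΨ : ContDiffAt ℝ ∞ (Ψ ε) (t₀, x₀, u₀) :=
    ContDiffAt.comp (g := fun q : ℝ × ℝ × ℝ × ℝ => Ψ q.1 q.2) (f := fun y => (ε, y)) _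
      (h.contDiffAt hεW) (contDiffAt_const.prodMk contDiffAt_id)
  have hmem := h.mapsTo ε _ hεW
  have key := time_component_eq_zero (b := b) (σ := σ) (g := g) (F := Ψ ε) (f₁ := f 0) (f₂ := f 1)
    (q₀ := (t₀, x₀)) (F' := spaceDeriv Ψ (t₀, x₀, u₀) ε) (l := l) (A := A)
    (by rw [hf0]; exact hΨ) (by rw [hf0]; exact h.hasFDerivAt_spaceDeriv hεW)
    (by rw [← hL]; exact L.surjective) hA
    (contDiff_quadratic t₀ x₀ u₀ q p 0).contDiffAt (contDiff_quadratic t₀ x₀ u₀ q p 1).contDiffAt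
    (hasFDerivAt_quadratic t₀ x₀ u₀ q p 0) (hasFDerivAt_quadratic t₀ x₀ u₀ q p 1)
    (fun t x => by simp only [hf]; ring)
    (by rw [hf0]; exact hσ _ hmem.1 _)
    (by
      rintro _ (rfl | rfl)
      · rw [hf0]; exact hE0
      · rw [hf0]; exact hE1)
  simpa [graphLift, l] using key

theorem IsLocalFlow.isProjectable (h : IsLocalFlow T v W Ψ)
    (hE : PreservesEquation T b σ g Ψ) (hσ : ∀ t ∈ Ioo 0 T, ∀ x : ℝ, σ t x ≠ 0)
    (hT : 0 < T) (hv : v.IsSmooth T) : v.IsProjectable T := by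
  have hderiv : ∀ t ∈ Ioo 0 T, ∀ x u p s : ℝ,
      HasDerivAt (fun s => v.θ t (x + s) (u + s * p)) 0 s := by
    intro t ht x u p s
    have h1 := h.hasDerivAt_toVec_of_spaceDeriv (p := (t, x + s, u + s * p)) (w := (0, 1, p))
      ⟨ht, mem_univ _⟩ (h.eventually_spaceDeriv_fst_eq_zero hE hσ ht _ _ _)
    have h2 : HasDerivAt (fun r : ℝ => v.θ t (x + s + r) (u + s * p + r * p)) 0 (s - s) := by
      rw [sub_self]
      simpa [PointField.toVec] using h1
    have h3 := h2.comp_sub_const s s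
    refine h3.congr_of_eventuallyEq (Eventually.of_forall fun r => ?_)
    change v.θ t (x + r) (u + r * p) = v.θ t (x + s + (r - s)) (u + s * p + (r - s) * p)
    congr 1 <;> ring
  have hconst : ∀ t ∈ Ioo 0 T, ∀ x u x' u' : ℝ, x ≠ x' → v.θ t x u = v.θ t x' u' := by
    intro t ht x u x' u' hne
    -- This slope makes the line pass through both points, which requires `x ≠ x'`.
    have hd := hderiv t ht x u ((u' - u) / (x' - x))
    have h1 := is_const_of_deriv_eq_zero (fun s => (hd s).differentiableAt)
      (fun s => (hd s).deriv) 0 (x' - x)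
    have h2 : x' - x ≠ 0 := sub_ne_zero.2 hne.symm
    have e1 : x + (x' - x) = x' := by ring
    have e2 : u + (x' - x) * ((u' - u) / (x' - x)) = u' := by field_simp; ring
    simpa [e1, e2] using h1
  have hcont : ∀ x u : ℝ, ContinuousOn (fun t => v.θ t x u) (Icc 0 T) := fun x u =>
    (ContinuousOn.comp (g := v.toVec) (f := fun t : ℝ => (t, x, u)) hv.continuousOn
      (by fun_prop) fun t ht => ⟨ht, mem_univ _⟩).fst
  refine ⟨fun t => v.θ t 0 0, fun t ht x u => ?_⟩
  have heq : EqOn (fun t => v.θ t x u) (fun t => v.θ t 0 0) (Ioo 0 T) := by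
    intro t ht
    -- Points on a common vertical line are compared through a third point with `x = 1`.
    by_cases hx : x = 0
    · exact (hconst t ht x u 1 0 (by simp [hx])).trans (hconst t ht 1 0 0 0 one_ne_zero)
    · exact hconst t ht x u 0 0 hx
  refine heq.of_subset_closure (hcont x u) (hcont 0 0) Ioo_subset_Icc_self ?_ ht
  rw [closure_Ioo hT.ne]

end Flow

end SemilinearPDE

theorem mainTheorem5 (T : ℝ) (hT : 0 < T) (b σ : ℝ → ℝ → ℝ) (g : ℝ → ℝ → ℝ → ℝ → ℝ)
    (H : ℝ → ℝ) (hσ : ∀ t ∈ Set.Ico 0 T, ∀ x : ℝ, σ t x ≠ 0) :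
    (∀ v : SemilinearPDE.PointField,
      SemilinearPDE.IsSymmetryOfEquation T b σ g v → v.IsProjectable T) ∧
    (∀ v : SemilinearPDE.PointField,
      SemilinearPDE.IsSymmetryOfTerminalProblem T b σ g H v → v.IsProjectable T) := by
  have hσ' : ∀ t ∈ Ioo 0 T, ∀ x : ℝ, σ t x ≠ 0 := fun t ht => hσ t (Ioo_subset_Ico_self ht)
  refine ⟨?_, ?_⟩
  · rintro v ⟨hv, W, Ψ, hΨ, hE⟩
    exact hΨ.isProjectable hE hσ' hT hv
  · rintro v ⟨hv, W, Ψ, hΨ, hE, -⟩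
    exact hΨ.isProjectable hE hσ' hT hv
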